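/- For non-zero integers $s_1,\dots,s_r$ and $n\ge 0$ put $$\zeta_n(s_1,\dots,s_r)=\sum_{n\ge n_1>n_2>\cdots>n_r\ge 1}\ \prod_{j=1}^r \frac{\operatorname{sgn}(s_j)^{n_j}}{n_j^{|s_j|}},\qquad \zeta(s_1,\dots,s_r)=\lim_{n\to\infty}\zeta_n(s_1,\dots,s_r)$$ whenever the limit exists. Write $\bar p$ for an entry $-p$, and $\{1\}_d$ for the entry $1$ repeated $d$ times. Then for all integers $m,k\ge 0$ every value of $\zeta$ occurring below exists, and $$\begin{aligned} &(-1)^{m+1}\sum_{i=0}^{m}\frac{(\ln 2)^i}{i!}\,\zeta(\bar 1,\{1\}_{m-i},3,\{1\}_k)+(-1)^{k+1}\sum_{i=0}^{k}\frac{(\ln 2)^i}{i!}\,\zeta(\bar 1,\{1\}_{k-i},3,\{1\}_m)\\ &\quad=\frac{(-1)^m}{(m+1)!}(\ln 2)^{m+1}\,\zeta(\bar 3,\{1\}_k)+\frac{(-1)^k}{(k+1)!}(\ln 2)^{k+1}\,\zeta(\bar 3,\{1\}_m)+\zeta(\bar 2,\{1\}_m)\,\zeta(\bar 2,\{1\}_k).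 \end{aligned}$$ -/

import Mathlib

open Filter Topology

namespace AltMZV

/-- The multiple harmonic number
`ζ_n(s₁, …, s_k) = ∑_{n ≥ n₁ > n₂ > ⋯ > n_k ≥ 1} ∏_j n_j ^ (-|s_j|) * sgn(s_j) ^ n_j`
of a list of nonzero integers, where a negative entry `-p` stands for the barred entry `p̄`.
The sum is written by choosing the largest index `n₁ = j` first, the remaining indices being
those of `ζ_{j-1}(s₂, …, s_k)`; the value at the empty list is `1`. -/
noncomputable def harm : List ℤ → ℕ → ℝ
  | [], _ => 1
  | s :: l, n =>
      ∑ j ∈ Finset.Icc 1 n, ((s.sign : ℤ) : ℝ) ^ j / (j : ℝ) ^ s.natAbs * harm l (j - 1)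

/-- The series `∑_{n₁ > ⋯ > n_k > 0}` converges, in the usual sense that its partial sums
`ζ_n(s)` (all indices at most `n`) have a real limit. -/
def Converges (s : List ℤ) : Prop :=
  ∃ v : ℝ, Tendsto (harm s) atTop (𝓝 v)

/-- The (alternating) multiple zeta value `ζ(s₁, …, s_k)`: the limit of the partial sums
`ζ_n(s₁, …, s_k)`. It is meaningful only together with `Converges s`. -/
noncomputable def zeta (s : List ℤ) : ℝ :=
  limUnder atTop (harm s)

/-- The block `{1}_d`: the entry `1` repeated `d` times. -/
def ones (d : ℕ) : List ℤ := List.replicate d 1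

end AltMZV

namespace AltMZV

/-! Write Li_s for the multiple polylogarithm series `polylog`. The operator (1-x)d/dx deletes a
leading 1, and x d/dx lowers a leading entry that is at least 2. Let E_{n,k} = `logConvolution n k`
= ∑ i ≤ n, log(1-x)^i/i! · Li_{{1}_{n-i},3,{1}_k}. Its derivative telescopes to log(1-x)^n/n! ·
Li_{3,{1}_k}'. Since Li_{{1}_n} = (-log(1-x))^n/n!, this gives ((-1)^{m+1} E_{m+1,k})' =
Li_{{1}_{m+1}} · Li_{2,{1}_k}/x = Li_{2,{1}_m}' · Li_{2,{1}_k}. Adding the same formula with m and k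
exchanged is the product rule, whence `logConvolution_add_logConvolution`.

The theorem is this formal identity at x = -1: log(1-x) becomes ln 2 and the leading entry of each
index becomes barred. The series converge there (`converges_neg_cons`), and Abel's limit theorem
(`tendsto_polylogValue_neg`) carries the identity over from |x| < 1. The i = n terms, whose index
starts with 3, give the ζ(3̄, …) terms. -/

open PowerSeries

/-! ### Formal multiple polylogarithms and their differential equations. -/

/-- The power series `∑ xⁿ¹ / (n₁ ^ |s₁| ⋯ n_r ^ |s_r|)` of the multiple polylogarithm of a list of
positive integers. -/
noncomputable def polylog : List ℤ → ℝ⟦X⟧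
  | [] => 1
  | s :: l => PowerSeries.mk fun n => ((n : ℝ) ^ s.natAbs)⁻¹ * harm l (n - 1)

lemma coeff_polylog_cons (s : ℤ) (l : List ℤ) (n : ℕ) :
    coeff n (polylog (s :: l)) = ((n : ℝ) ^ s.natAbs)⁻¹ * harm l (n - 1) := by
  simp [polylog]

lemma coeff_zero_polylog_cons {s : ℤ} (hs : 0 < s) (l : List ℤ) :
    coeff 0 (polylog (s :: l)) = 0 := by
  have : s.natAbs ≠ 0 := by omega
  simp [polylog, this]

lemma harm_succ {s : ℤ} (hs : 0 < s) (l : List ℤ) (n : ℕ) :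
    harm (s :: l) (n + 1)
      = harm (s :: l) n + (((n + 1 : ℕ) : ℝ) ^ s.natAbs)⁻¹ * harm l n := by
  simp only [harm]
  rw [Finset.sum_Icc_succ_top (by omega), Int.sign_eq_one_of_pos hs]
  simp

lemma harm_zero_cons (s : ℤ) (l : List ℤ) : harm (s :: l) 0 = 0 := by simp [harm]

/-- `polylog l = (1 - x) ∑ ζ_n(l) xⁿ`. -/
lemma polylog_eq_one_sub_X_mul (l : List ℤ) (hl : ∀ s ∈ l, 0 < s) :
    polylog l = (1 - X) * PowerSeries.mk (harm l) := by
  ext n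
  rw [sub_mul, one_mul, map_sub]
  cases l with
  | nil =>
    cases n with
    | zero => simp [polylog, harm]
    | succ n => simp [polylog, harm, coeff_succ_X_mul, coeff_one]
  | cons s l =>
    have hs : 0 < s := hl s (by simp)
    cases n with
    | zero => simp [coeff_zero_polylog_cons hs, harm_zero_cons]
    | succ n =>
      rw [coeff_succ_X_mul, coeff_polylog_cons, coeff_mk, coeff_mk, harm_succ hs]
      simp

lemma X_mul_derivative_polylog (p : ℕ) (l : List ℤ) :
    X * d⁄dX ℝ (polylog (((p + 2 : ℕ) : ℤ) :: l)) = polylog (((p + 1 : ℕ) : ℤ) :: l) := by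
  ext n
  cases n with
  | zero => rw [coeff_zero_polylog_cons (by positivity)]; simp
  | succ n =>
    rw [coeff_succ_X_mul, coeff_derivative, coeff_polylog_cons, coeff_polylog_cons,
      Int.natAbs_natCast, Int.natAbs_natCast]
    have : ((n : ℝ) + 1) ≠ 0 := by positivity
    push_cast
    field_simp
    ring

lemma one_sub_X_mul_derivative_polylog (l : List ℤ) (hl : ∀ s ∈ l, 0 < s) :
    (1 - X) * d⁄dX ℝ (polylog (1 :: l)) = polylog l := by
  rw [polylog_eq_one_sub_X_mul l hl]
  congr 1
  ext n
  rw [coeff_derivative, coeff_polylog_cons, coeff_mk]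
  have : ((n : ℝ) + 1) ≠ 0 := by positivity
  simp
  field_simp

lemma one_sub_X_ne_zero : (1 - X : ℝ⟦X⟧) ≠ 0 := by
  intro h
  simpa using congrArg (coeff 0) h

lemma ones_succ (d : ℕ) : ones (d + 1) = 1 :: ones d := rfl

lemma pos_of_mem_ones {d : ℕ} {s : ℤ} (h : s ∈ ones d) : 0 < s := by
  rw [List.eq_of_mem_replicate h]; exact one_pos

lemma pos_of_mem_ones_append {a k : ℕ} {s : ℤ} (h : s ∈ ones a ++ 3 :: ones k) : 0 < s := by
  rcases List.mem_append.1 h with h | h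
  · exact pos_of_mem_ones h
  · rcases List.mem_cons.1 h with h | h
    · omega
    · exact pos_of_mem_ones h

/-- By induction both sides have the same image under (1-x)d/dx and the same constant term; the
factor 1-x cancels because power series over ℝ form a domain. -/
lemma polylog_ones (d : ℕ) :
    polylog (ones d) = C (1 / (d.factorial : ℝ)) * polylog [1] ^ d := by
  induction d with
  | zero => simp [ones, polylog]
  | succ d ih =>
    apply PowerSeries.derivative.ext
    · apply mul_left_cancel₀ one_sub_X_ne_zero
      have h1 := one_sub_X_mul_derivative_polylog [] (by simp)
      have h2 := one_sub_X_mul_derivative_polylog (ones d) (fun s => pos_of_mem_ones)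
      rw [ones_succ, h2, ih, Derivation.leibniz, derivative_C, Derivation.leibniz_pow]
      have h3 : (1 - X : ℝ⟦X⟧) * (C (1 / ((d + 1).factorial : ℝ)) * (((d + 1 : ℕ) : ℝ⟦X⟧) * (polylog [1] ^ d *
          d⁄dX ℝ (polylog [1])))) = C (1 / ((d + 1).factorial : ℝ)) * ((d + 1 : ℕ) : ℝ⟦X⟧) *
          polylog [1] ^ d * ((1 - X) * d⁄dX ℝ (polylog [1])) := by ring
      simp only [smul_eq_mul, mul_zero, add_zero, nsmul_eq_mul, Nat.add_sub_cancel]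
      rw [h3, h1, ← map_natCast (C (R := ℝ)), ← map_mul]
      have h4 : (1 / ((d + 1).factorial : ℝ)) * ((d + 1 : ℕ) : ℝ) = 1 / (d.factorial : ℝ) := by
        rw [Nat.factorial_succ]; push_cast; field_simp
      rw [h4]; simp [polylog]
    · have h5 : ∀ l, constantCoeff (polylog (1 :: l)) = 0 := fun l => by
        rw [← coeff_zero_eq_constantCoeff_apply]
        exact coeff_zero_polylog_cons one_pos l
      simp [ones_succ, h5]

/-! ### The formal identity between convolutions and products. -/

/-- The convolution of the divided powers of `-polylog [1] = log (1 - x)` with the polylogarithms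
`polylog ({1}_j, 3, {1}_k)`. -/
noncomputable def logConvolution (n k : ℕ) : ℝ⟦X⟧ :=
  ∑ i ∈ Finset.range (n + 1), C ((-1) ^ i / (i.factorial : ℝ)) * polylog [1] ^ i *
    polylog (ones (n - i) ++ 3 :: ones k)

lemma one_sub_X_mul_derivative_log_pow (i : ℕ) :
    (1 - X) * d⁄dX ℝ (C ((-1) ^ (i + 1) / ((i + 1).factorial : ℝ)) * polylog [1] ^ (i + 1))
      = - (C ((-1) ^ i / (i.factorial : ℝ)) * polylog [1] ^ i) := by
  have h (j : ℕ) : C ((-1) ^ j / (j.factorial : ℝ)) * polylog [1] ^ j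
      = C ((-1) ^ j) * polylog (ones j) := by
    rw [polylog_ones, ← mul_assoc, ← map_mul, mul_one_div]
  rw [h, h, Derivation.leibniz, derivative_C, ones_succ, smul_zero, add_zero, smul_eq_mul,
    mul_left_comm, one_sub_X_mul_derivative_polylog _ (fun s => pos_of_mem_ones), pow_succ]
  simp

/-- Under (1-x)d/dx the factors obey w_{i+1} ↦ -w_i and c_{j+1} ↦ c_j, so the product rule
telescopes; only the term differentiating c_0 survives. -/
lemma one_sub_X_mul_derivative_logConvolution (n k : ℕ) :
    (1 - X) * d⁄dX ℝ (logConvolution n k)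
      = C ((-1) ^ n / (n.factorial : ℝ)) * polylog [1] ^ n *
        ((1 - X) * d⁄dX ℝ (polylog (3 :: ones k))) := by
  set w : ℕ → ℝ⟦X⟧ := fun i => C ((-1) ^ i / (i.factorial : ℝ)) * polylog [1] ^ i with hw
  set c : ℕ → ℝ⟦X⟧ := fun j => polylog (ones j ++ 3 :: ones k) with hc
  have hw0 : d⁄dX ℝ (w 0) = 0 := by simp [hw]
  have hw1 (i : ℕ) : (1 - X) * d⁄dX ℝ (w (i + 1)) = -w i := one_sub_X_mul_derivative_log_pow i
  have hc1 (j : ℕ) : (1 - X) * d⁄dX ℝ (c (j + 1)) = c j :=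
    one_sub_X_mul_derivative_polylog _ (fun s => pos_of_mem_ones_append)
  have hE : logConvolution n k = ∑ i ∈ Finset.range (n + 1), w i * c (n - i) := rfl
  have hterm (i : ℕ) : (1 - X) * d⁄dX ℝ (w i * c (n - i))
      = w i * ((1 - X) * d⁄dX ℝ (c (n - i))) + ((1 - X) * d⁄dX ℝ (w i)) * c (n - i) := by
    rw [Derivation.leibniz]; simp only [smul_eq_mul]; ring
  change _ = w n * ((1 - X) * d⁄dX ℝ (c 0))
  rw [hE, map_sum, Finset.mul_sum, Finset.sum_congr rfl (fun i _ => hterm i),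
    Finset.sum_add_distrib, Finset.sum_range_succ, Finset.sum_range_succ' (n := n)]
  simp only [hw1, hw0, mul_zero, zero_mul, add_zero, Nat.sub_self]
  have : ∑ i ∈ Finset.range n, w i * ((1 - X) * d⁄dX ℝ (c (n - i)))
      = - ∑ i ∈ Finset.range n, -w i * c (n - (i + 1)) := by
    rw [← Finset.sum_neg_distrib]
    refine Finset.sum_congr rfl fun i hi => ?_
    have hi' := Finset.mem_range.1 hi
    rw [show n - i = (n - (i + 1)) + 1 by omega, hc1]
    ring
  rw [this]; ring

lemma constantCoeff_polylog_cons {s : ℤ} (hs : 0 < s) (l : List ℤ) :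
    constantCoeff (polylog (s :: l)) = 0 := by
  rw [← coeff_zero_eq_constantCoeff_apply, coeff_zero_polylog_cons hs]

lemma constantCoeff_logConvolution (n k : ℕ) : constantCoeff (logConvolution n k) = 0 := by
  rw [logConvolution, map_sum]
  refine Finset.sum_eq_zero fun i _ => ?_
  rcases Nat.eq_zero_or_pos i with rfl | hi
  · cases n with
    | zero => simp [ones, constantCoeff_polylog_cons]
    | succ n => simp [ones_succ, constantCoeff_polylog_cons]
  · simp [constantCoeff_polylog_cons, hi.ne']

lemma X_mul_derivative_logConvolution (m k : ℕ) :
    (1 - X) * (X * d⁄dX ℝ ((-1) ^ (m + 1) * logConvolution (m + 1) k))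
      = (1 - X) * (X * d⁄dX ℝ (polylog (2 :: ones m)) * polylog (2 :: ones k)) := by
  have h1 := X_mul_derivative_polylog 0 (ones m)
  have h2 := X_mul_derivative_polylog 1 (ones k)
  norm_num at h1 h2
  have h3 := one_sub_X_mul_derivative_logConvolution (m + 1) k
  have h4 : d⁄dX ℝ ((-1) ^ (m + 1) * logConvolution (m + 1) k)
      = (-1) ^ (m + 1) * d⁄dX ℝ (logConvolution (m + 1) k) := by
    rcases neg_one_pow_eq_or ℝ⟦X⟧ (m + 1) with h | h <;> rw [h] <;> simp
  have h5 := polylog_ones (m + 1)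
  rw [ones_succ] at h5
  have h6 : C ((-1) ^ (m + 1) / ((m + 1).factorial : ℝ))
      = (-1) ^ (m + 1) * C (1 / ((m + 1).factorial : ℝ)) := by
    rw [div_eq_mul_one_div, map_mul]; simp
  rw [h6] at h3
  have h7 : ((-1) ^ (m + 1) * (-1) ^ (m + 1) : ℝ⟦X⟧) = 1 := by
    rw [← mul_pow]; simp
  rw [h4, h1, h5, ← h2]
  -- `h7` removes the square of the sign: one factor comes from the statement, the other from
  -- log(1-x) = -Li_1.
  linear_combination X * (-1) ^ (m + 1) * h3 + (X * (1 - X) *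
    C (1 / ((m + 1).factorial : ℝ)) * polylog [1] ^ (m + 1) * d⁄dX ℝ (polylog (3 :: ones k))) * h7

theorem logConvolution_add_logConvolution (m k : ℕ) :
    (-1) ^ (m + 1) * logConvolution (m + 1) k + (-1) ^ (k + 1) * logConvolution (k + 1) m
      = polylog (2 :: ones m) * polylog (2 :: ones k) := by
  apply PowerSeries.derivative.ext
  · apply mul_left_cancel₀ (mul_ne_zero one_sub_X_ne_zero (X_ne_zero (R := ℝ)))
    have h1 := X_mul_derivative_logConvolution m k
    have h2 := X_mul_derivative_logConvolution k m
    rw [map_add, Derivation.leibniz (D := d⁄dX ℝ) (polylog (2 :: ones m))]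
    simp only [smul_eq_mul]
    linear_combination h1 + h2
  · simp [constantCoeff_logConvolution, constantCoeff_polylog_cons]

/-! ### Growth of multiple harmonic numbers and convergence of the alternating series. -/

lemma harm_nonneg (l : List ℤ) (hl : ∀ s ∈ l, 0 < s) (n : ℕ) : 0 ≤ harm l n := by
  induction l generalizing n with
  | nil => simp [harm]
  | cons s l ih =>
    have hs : 0 < s := hl s (by simp)
    simp only [harm, Int.sign_eq_one_of_pos hs]
    refine Finset.sum_nonneg fun j _ => mul_nonneg ?_ (ih (fun t ht => hl t (by simp [ht])) _)
    simp only [Int.cast_one, one_pow]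
    positivity

lemma two_mul_sqrt_add_inv_le (n : ℕ) :
    2 * √(n : ℝ) + (√((n : ℝ) + 1))⁻¹ ≤ 2 * √((n : ℝ) + 1) := by
  have hb : 0 < √((n : ℝ) + 1) := Real.sqrt_pos.2 (by positivity)
  have ha2 : √(n : ℝ) ^ 2 = n := Real.sq_sqrt (by positivity)
  have hb2 : √((n : ℝ) + 1) ^ 2 = n + 1 := Real.sq_sqrt (by positivity)
  rw [← mul_le_mul_iff_left₀ hb, add_mul, inv_mul_cancel₀ hb.ne']
  nlinarith [sq_nonneg (√(n : ℝ) - √((n : ℝ) + 1))]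

lemma inv_pow_succ_le {x : ℝ} (hx : 1 ≤ x) {p : ℕ} (hp : p ≠ 0) : (x ^ p)⁻¹ ≤ x⁻¹ :=
  inv_anti₀ (by linarith) (le_self_pow₀ hx hp)

/-- The true growth is at most a power of log n. A square root is enough for convergence and is
stable under summation against 1/n, by the telescoping bound `two_mul_sqrt_add_inv_le`. -/
lemma harm_le (l : List ℤ) (hl : ∀ s ∈ l, 0 < s) (n : ℕ) :
    harm l n ≤ 2 ^ l.length * √((n : ℝ) + 1) := by
  induction l generalizing n with
  | nil =>
    simp only [harm, List.length_nil, pow_zero, one_mul]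
    exact Real.one_le_sqrt.2 (by linarith [n.cast_nonneg (α := ℝ)])
  | cons s l ih =>
    have hs : 0 < s := hl s (by simp)
    have hl' : ∀ t ∈ l, 0 < t := fun t ht => hl t (by simp [ht])
    -- With √n in place of √(n+1) the inner induction starts from 0 ≤ 0 and telescopes.
    suffices h : harm (s :: l) n ≤ 2 ^ (s :: l).length * √(n : ℝ) from
      h.trans (mul_le_mul_of_nonneg_left (Real.sqrt_le_sqrt (by linarith)) (by positivity))
    induction n with
    | zero => simp [harm_zero_cons]
    | succ n ihn =>
      have h1 : (((n + 1 : ℕ) : ℝ) ^ s.natAbs)⁻¹ * harm l n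
          ≤ ((n : ℝ) + 1)⁻¹ * (2 ^ l.length * √((n : ℝ) + 1)) := by
        refine mul_le_mul ?_ (ih hl' n) (harm_nonneg l hl' n) (by positivity)
        push_cast
        exact inv_pow_succ_le (by linarith [n.cast_nonneg (α := ℝ)]) (by omega)
      have hb : 0 < √((n : ℝ) + 1) := Real.sqrt_pos.2 (by positivity)
      have h2 : ((n : ℝ) + 1)⁻¹ * (2 ^ l.length * √((n : ℝ) + 1))
          = 2 ^ l.length * (√((n : ℝ) + 1))⁻¹ := by
        nth_rewrite 1 [← Real.mul_self_sqrt (show (0 : ℝ) ≤ (n : ℝ) + 1 by positivity)]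
        field_simp
      rw [harm_succ hs]
      have h3 := mul_le_mul_of_nonneg_left (two_mul_sqrt_add_inv_le n)
        (show (0 : ℝ) ≤ 2 ^ l.length by positivity)
      rw [List.length_cons, pow_succ] at ihn ⊢
      push_cast
      push_cast at h1 ⊢
      linarith

/-- An alternating series whose terms tend to zero and have bounded variation converges. -/
lemma exists_tendsto_alternating_of_summable_abs_sub {b : ℕ → ℝ} (h0 : Tendsto b atTop (𝓝 0))
    (hs : Summable fun n => |b n - b (n + 1)|) :
    ∃ v, Tendsto (fun N => ∑ n ∈ Finset.range N, (-1) ^ n * b n) atTop (𝓝 v) := by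
  have hd : Summable fun n => (-1 : ℝ) ^ n * (b n - b (n + 1)) := by
    refine Summable.of_norm ?_
    simpa [abs_mul] using hs
  have hb : Tendsto (fun N => (-1 : ℝ) ^ N * b N) atTop (𝓝 0) := by
    rw [tendsto_zero_iff_norm_tendsto_zero] at h0 ⊢
    simpa [abs_mul] using h0
  -- Summation by parts; monotonicity of `b` is not needed. This matters for terms such as
  -- H_n/(n+1), which start at 0 and rise before they decay.
  have hsum (N : ℕ) : ∑ n ∈ Finset.range N, (-1 : ℝ) ^ n * b n
      = (∑ n ∈ Finset.range N, (-1 : ℝ) ^ n * (b n - b (n + 1)) + b 0 - (-1) ^ N * b N) / 2 := by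
    induction N with
    | zero => simp
    | succ N ih =>
      rw [Finset.sum_range_succ, Finset.sum_range_succ, ih, pow_succ]
      ring
  refine ⟨_, ((((hd.hasSum.tendsto_sum_nat).add_const (b 0)).sub hb).div_const 2).congr
    fun N => (hsum N).symm⟩

lemma summable_inv_sq_mul_sqrt :
    Summable fun n : ℕ => (((n : ℝ) + 1) ^ 2)⁻¹ * √((n : ℝ) + 1) := by
  have h := (summable_nat_add_iff 1).2 (Real.summable_nat_rpow_inv.2 (by norm_num : (1 : ℝ) < 3 / 2))
  refine h.congr fun n => ?_
  have hx : (0 : ℝ) < (n : ℝ) + 1 := by positivity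
  push_cast
  rw [Real.sqrt_eq_rpow, ← Real.rpow_natCast, ← Real.rpow_neg hx.le, ← Real.rpow_neg hx.le,
    ← Real.rpow_add hx]
  norm_num

lemma harm_neg_cons {s : ℤ} (hs : 0 < s) (l : List ℤ) (N : ℕ) :
    harm (-s :: l) N
      = -∑ n ∈ Finset.range N, (-1) ^ n * ((((n : ℝ) + 1) ^ s.natAbs)⁻¹ * harm l n) := by
  have hsg : (-s).sign = -1 := by rw [Int.sign_neg, Int.sign_eq_one_of_pos hs]
  induction N with
  | zero => simp [harm]
  | succ N ih =>
    simp only [harm, hsg, Int.natAbs_neg] at ih ⊢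
    rw [Finset.sum_Icc_succ_top (by omega), ih, Finset.sum_range_succ]
    push_cast
    rw [pow_succ, div_eq_mul_inv]
    ring

lemma abs_term_sub_term_succ_le (s : ℤ) (l : List ℤ) (hs : 0 < s) (hl : ∀ s ∈ l, 0 < s) (n : ℕ) :
    |((n : ℝ) + 1)⁻¹ * harm (s :: l) n - ((n : ℝ) + 1 + 1)⁻¹ * harm (s :: l) (n + 1)|
      ≤ 2 ^ (l.length + 1) * ((((n : ℝ) + 1) ^ 2)⁻¹ * √((n : ℝ) + 1)) := by
  have hx : (1 : ℝ) ≤ (n : ℝ) + 1 := by linarith [n.cast_nonneg (α := ℝ)]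
  set x : ℝ := (n : ℝ) + 1 with hxdef
  have hx0 : 0 < x := by linarith
  have hsl : ∀ t ∈ s :: l, 0 < t := by
    intro t ht
    rcases List.mem_cons.1 ht with rfl | h
    exacts [hs, hl t h]
  have e : x⁻¹ * harm (s :: l) n - (x + 1)⁻¹ * harm (s :: l) (n + 1)
      = x⁻¹ * (x + 1)⁻¹ * harm (s :: l) n - (x + 1)⁻¹ * ((x ^ s.natAbs)⁻¹ * harm l n) := by
    rw [harm_succ hs]
    push_cast
    rw [← hxdef]
    field_simp
    ring
  have hinv : (x + 1)⁻¹ ≤ x⁻¹ := inv_anti₀ hx0 (by linarith)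
  have h1 := harm_le (s :: l) hsl n
  have h2 := harm_le l hl n
  have h1' := harm_nonneg (s :: l) hsl n
  have h2' := harm_nonneg l hl n
  rw [← hxdef] at h1 h2
  have hsq : (x ^ 2)⁻¹ = x⁻¹ * x⁻¹ := by rw [sq, mul_inv]
  have b1 : x⁻¹ * (x + 1)⁻¹ * harm (s :: l) n ≤ (x ^ 2)⁻¹ * (2 ^ (l.length + 1) * √x) := by
    rw [hsq]
    gcongr
    exact h1
  have b2 : (x + 1)⁻¹ * ((x ^ s.natAbs)⁻¹ * harm l n) ≤ (x ^ 2)⁻¹ * (2 ^ (l.length + 1) * √x) := by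
    rw [hsq, mul_assoc]
    have h3 : (x ^ s.natAbs)⁻¹ ≤ x⁻¹ := inv_pow_succ_le hx (by omega)
    have h4 : (2 : ℝ) ^ l.length * √x ≤ 2 ^ (l.length + 1) * √x := by
      gcongr <;> norm_num
    gcongr
    exact h2.trans h4
  rw [e]
  have p1 : 0 ≤ x⁻¹ * (x + 1)⁻¹ * harm (s :: l) n := by positivity
  have p2 : 0 ≤ (x + 1)⁻¹ * ((x ^ s.natAbs)⁻¹ * harm l n) := by positivity
  -- Both parts of the difference lie between 0 and the same bound, so no factor 2 is lost.
  rw [mul_left_comm, abs_le]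
  constructor <;> linarith

theorem converges_neg_cons {s : ℤ} (hs : 0 < s) (l : List ℤ) (hl : ∀ t ∈ l, 0 < t) :
    Converges (-s :: l) := by
  set b : ℕ → ℝ := fun n => (((n : ℝ) + 1) ^ s.natAbs)⁻¹ * harm l n with hb
  suffices h : ∃ v, Tendsto (fun N => ∑ n ∈ Finset.range N, (-1) ^ n * b n) atTop (𝓝 v) by
    obtain ⟨v, hv⟩ := h
    exact ⟨-v, hv.neg.congr fun N => (harm_neg_cons hs l N).symm⟩
  have hbn (n : ℕ) : 0 ≤ b n := mul_nonneg (by positivity) (harm_nonneg l hl n)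
  have hx (n : ℕ) : (1 : ℝ) ≤ (n : ℝ) + 1 := by linarith [n.cast_nonneg (α := ℝ)]
  -- A leading entry 1 may give only conditional convergence, handled by bounded variation; from 2
  -- on, comparison with n^(-3/2) gives absolute convergence.
  rcases (show s = 1 ∨ 2 ≤ s by omega) with rfl | hs2
  · refine exists_tendsto_alternating_of_summable_abs_sub ?_ ?_
    · have hlim : Tendsto (fun n : ℕ => (2 : ℝ) ^ l.length * (√((n : ℝ) + 1))⁻¹) atTop (𝓝 0) := by
        have h1 : Tendsto (fun n : ℕ => √((n : ℝ) + 1)) atTop atTop :=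
          Real.tendsto_sqrt_atTop.comp
            (tendsto_atTop_add_const_right _ _ tendsto_natCast_atTop_atTop)
        simpa using h1.inv_tendsto_atTop.const_mul ((2 : ℝ) ^ l.length)
      refine squeeze_zero hbn (fun n => ?_) hlim
      have h2 : b n ≤ ((n : ℝ) + 1)⁻¹ * (2 ^ l.length * √((n : ℝ) + 1)) := by
        simp only [hb, Int.natAbs_one, pow_one]
        exact mul_le_mul_of_nonneg_left (harm_le l hl n) (by positivity)
      refine h2.trans (le_of_eq ?_)
      have hsq : 0 < √((n : ℝ) + 1) := Real.sqrt_pos.2 (by linarith [hx n])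
      nth_rewrite 1 [← Real.mul_self_sqrt (show (0 : ℝ) ≤ (n : ℝ) + 1 by positivity)]
      field_simp
    · cases l with
      | nil =>
        refine Summable.of_nonneg_of_le (fun n => abs_nonneg _) (fun n => ?_)
          summable_inv_sq_mul_sqrt
        have e : b n - b (n + 1) = ((n : ℝ) + 1)⁻¹ * ((n : ℝ) + 1 + 1)⁻¹ := by
          simp only [hb, harm, Int.natAbs_one, pow_one]
          push_cast
          field_simp
          ring
        rw [e, abs_of_nonneg (by positivity), sq, mul_inv]
        have h1 : ((n : ℝ) + 1 + 1)⁻¹ ≤ ((n : ℝ) + 1)⁻¹ := inv_anti₀ (by positivity) (by linarith)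
        have h2 : 1 ≤ √((n : ℝ) + 1) := Real.one_le_sqrt.2 (hx n)
        calc _ ≤ ((n : ℝ) + 1)⁻¹ * ((n : ℝ) + 1)⁻¹ := by gcongr
          _ ≤ _ := le_mul_of_one_le_right (by positivity) h2
      | cons t l =>
        refine Summable.of_nonneg_of_le (fun n => abs_nonneg _) (fun n => ?_)
          (summable_inv_sq_mul_sqrt.mul_left (2 ^ (l.length + 1)))
        have := abs_term_sub_term_succ_le t l (hl t (by simp)) (fun r hr => hl r (by simp [hr])) n
        simpa [hb] using this
  · have hsum : Summable fun n => (-1 : ℝ) ^ n * b n := by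
      refine Summable.of_norm_bounded (summable_inv_sq_mul_sqrt.mul_left (2 ^ l.length)) fun n => ?_
      rw [norm_mul, norm_pow, norm_neg, norm_one, one_pow, one_mul, Real.norm_of_nonneg (hbn n),
        mul_left_comm]
      refine mul_le_mul ?_ (harm_le l hl n) (harm_nonneg l hl n) (by positivity)
      exact inv_anti₀ (by positivity) (pow_le_pow_right₀ (hx n) (by omega))
    exact ⟨_, hsum.hasSum.tendsto_sum_nat⟩

lemma zeta_eq_of_tendsto {s : List ℤ} {v : ℝ} (h : Tendsto (harm s) atTop (𝓝 v)) : zeta s = v :=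
  h.limUnder_eq

lemma Converges.tendsto {s : List ℤ} (h : Converges s) : Tendsto (harm s) atTop (𝓝 (zeta s)) := by
  obtain ⟨v, hv⟩ := h
  rwa [zeta_eq_of_tendsto hv]

/-! ### Evaluation of power series; absolute convergence permits Cauchy products. -/

/-- The power series `f` converges absolutely at `x`, with sum `v`. -/
def HasValue (x : ℝ) (f : ℝ⟦X⟧) (v : ℝ) : Prop :=
  (Summable fun n => ‖coeff n f * x ^ n‖) ∧ ∑' n, coeff n f * x ^ n = v

namespace HasValue

variable {x v w : ℝ} {f g : ℝ⟦X⟧}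

lemma unique (hf : HasValue x f v) (hg : HasValue x f w) : v = w := hf.2.symm.trans hg.2

lemma const (r : ℝ) : HasValue x (C r) r := by
  have h : ∀ n, n ≠ 0 → coeff n (C r) * x ^ n = 0 := fun n hn => by simp [coeff_C, hn]
  refine ⟨summable_of_ne_finset_zero (s := {0}) fun n hn => ?_, ?_⟩
  · rw [h n (by simpa using hn), norm_zero]
  · rw [tsum_eq_single 0 h]; simp

lemma add (hf : HasValue x f v) (hg : HasValue x g w) : HasValue x (f + g) (v + w) := by
  refine ⟨(hf.1.add hg.1).of_nonneg_of_le (fun n => norm_nonneg _) fun n => ?_, ?_⟩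
  · rw [map_add, add_mul]; exact norm_add_le _ _
  · simp only [map_add, add_mul]
    rw [hf.1.of_norm.tsum_add hg.1.of_norm, hf.2, hg.2]

lemma mul (hf : HasValue x f v) (hg : HasValue x g w) : HasValue x (f * g) (v * w) := by
  have h (n : ℕ) : coeff n (f * g) * x ^ n = ∑ kl ∈ Finset.HasAntidiagonal.antidiagonal n,
      (coeff kl.1 f * x ^ kl.1) * (coeff kl.2 g * x ^ kl.2) := by
    rw [coeff_mul, Finset.sum_mul]
    refine Finset.sum_congr rfl fun kl hkl => ?_
    rw [← Finset.HasAntidiagonal.mem_antidiagonal.1 hkl, pow_add]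
    ring
  have h1 := summable_norm_sum_mul_antidiagonal_of_summable_norm hf.1 hg.1
  have h2 := tsum_mul_tsum_eq_tsum_sum_antidiagonal_of_summable_norm hf.1 hg.1
  rw [hf.2, hg.2] at h2
  exact ⟨h1.congr fun n => congrArg norm (h n).symm, (tsum_congr h).trans h2.symm⟩

lemma pow (hf : HasValue x f v) (n : ℕ) : HasValue x (f ^ n) (v ^ n) := by
  induction n with
  | zero => simpa using const (x := x) 1
  | succ n ih => rw [pow_succ, pow_succ]; exact ih.mul hf

lemma sum {ι : Type*} (s : Finset ι) {F : ι → ℝ⟦X⟧} {V : ι → ℝ}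
    (h : ∀ i ∈ s, HasValue x (F i) (V i)) : HasValue x (∑ i ∈ s, F i) (∑ i ∈ s, V i) := by
  classical
  induction s using Finset.induction_on with
  | empty => simpa using const (x := x) 0
  | insert a s ha ih =>
    rw [Finset.sum_insert ha, Finset.sum_insert ha]
    exact (h a (by simp)).add (ih fun i hi => h i (by simp [hi]))

end HasValue

/-! ### Polylogarithms on (-1, 1) and their limits at -1. -/

/-- The value of a multiple polylogarithm at `x`. -/
noncomputable def polylogValue (l : List ℤ) (x : ℝ) : ℝ := ∑' n, coeff n (polylog l) * x ^ n

lemma hasValue_polylog_cons {s : ℤ} (hs : 0 < s) (l : List ℤ) (hl : ∀ t ∈ l, 0 < t) {x : ℝ}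
    (hx : |x| < 1) : HasValue x (polylog (s :: l)) (polylogValue (s :: l) x) := by
  refine ⟨?_, rfl⟩
  -- The coefficients are at most 2^length · (n+1), so the series is compared with ∑ (n+1)|x|^n.
  have h1 := summable_pow_mul_geometric_of_norm_lt_one 1 (r := |x|) (by simpa using hx)
  have h2 := (h1.add (summable_geometric_of_lt_one (abs_nonneg x) hx)).mul_left (2 ^ l.length)
  refine h2.of_nonneg_of_le (fun n => norm_nonneg _) fun n => ?_
  rw [norm_mul, norm_pow, Real.norm_eq_abs x, pow_one, ← add_one_mul, ← mul_assoc]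
  refine mul_le_mul_of_nonneg_right ?_ (by positivity)
  cases n with
  | zero => rw [coeff_zero_polylog_cons hs, norm_zero]; positivity
  | succ n =>
    rw [coeff_polylog_cons, Real.norm_of_nonneg (mul_nonneg (by positivity) (harm_nonneg l hl _)),
      Nat.add_sub_cancel]
    have hn : (0 : ℝ) ≤ n := n.cast_nonneg
    have h3 : ((((n + 1 : ℕ) : ℝ)) ^ s.natAbs)⁻¹ ≤ 1 :=
      inv_le_one_of_one_le₀ (one_le_pow₀ (by push_cast; linarith))
    have h4 : √((n : ℝ) + 1) ≤ ((n + 1 : ℕ) : ℝ) + 1 := by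
      rw [Real.sqrt_le_left (by positivity)]
      push_cast
      nlinarith
    calc _ ≤ 1 * harm l n := mul_le_mul_of_nonneg_right h3 (harm_nonneg l hl n)
      _ = harm l n := one_mul _
      _ ≤ 2 ^ l.length * √((n : ℝ) + 1) := harm_le l hl n
      _ ≤ _ := by gcongr

lemma polylogValue_one {x : ℝ} (hx : |x| < 1) : polylogValue [1] x = -Real.log (1 - x) := by
  have h := Real.hasSum_pow_div_log_of_abs_lt_one hx
  have hs := (hasValue_polylog_cons one_pos [] (by simp) hx).1.of_norm
  rw [polylogValue, hs.tsum_eq_zero_add, coeff_zero_polylog_cons one_pos, zero_mul, zero_add,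
    ← h.tsum_eq]
  refine tsum_congr fun n => ?_
  rw [coeff_polylog_cons]
  simp [harm, div_eq_inv_mul]

lemma tendsto_polylogValue_neg {s : ℤ} (hs : 0 < s) (l : List ℤ) (hl : ∀ t ∈ l, 0 < t) :
    Tendsto (fun t : ℝ => polylogValue (s :: l) (-t)) (𝓝[<] 1) (𝓝 (zeta (-s :: l))) := by
  have h : Tendsto (fun N => ∑ n ∈ Finset.range N, coeff n (polylog (s :: l)) * (-1) ^ n) atTop
      (𝓝 (zeta (-s :: l))) := by
    -- The constant coefficient vanishes, so the first N+1 terms of the power series at -1 add up to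
    -- `harm (-s :: l) N`.
    rw [← tendsto_add_atTop_iff_nat 1]
    refine (converges_neg_cons hs l hl).tendsto.congr fun N => ?_
    rw [harm_neg_cons hs, Finset.sum_range_succ', coeff_zero_polylog_cons hs, zero_mul, add_zero,
      ← Finset.sum_neg_distrib]
    refine Finset.sum_congr rfl fun n _ => ?_
    rw [coeff_polylog_cons, Nat.add_sub_cancel, pow_succ]
    push_cast
    ring
  -- Abel's limit theorem, with the sign (-1)^n absorbed into the coefficients.
  refine (Real.tendsto_tsum_powerSeries_nhdsWithin_lt h).congr fun t => ?_
  refine tsum_congr fun n => ?_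
  rw [neg_pow t, mul_assoc]

/-- Here the limit is needed in closed form; it follows from continuity of log(1-x) at -1. -/
lemma tendsto_polylogValue_one_neg :
    Tendsto (fun t : ℝ => polylogValue [1] (-t)) (𝓝[<] 1) (𝓝 (-Real.log 2)) := by
  have h : Tendsto (fun t : ℝ => -Real.log (1 - -t)) (𝓝[<] 1) (𝓝 (-Real.log (1 - -1))) := by
    refine Tendsto.mono_left (ContinuousAt.tendsto ?_) nhdsWithin_le_nhds
    exact ((continuousAt_const.sub continuousAt_id.neg).log (by norm_num)).neg
  rw [show (1 : ℝ) - -1 = 2 by norm_num] at h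
  refine h.congr' ?_
  filter_upwards [Ioo_mem_nhdsLT (show (0 : ℝ) < 1 by norm_num)] with t ht
  rw [polylogValue_one (by rw [abs_neg, abs_of_pos ht.1]; exact ht.2)]

lemma hasValue_logConvolution {x : ℝ} (hx : |x| < 1) (n k : ℕ) :
    HasValue x (logConvolution n k) (∑ i ∈ Finset.range (n + 1),
      (-1) ^ i / (i.factorial : ℝ) * polylogValue [1] x ^ i *
        polylogValue (ones (n - i) ++ 3 :: ones k) x) := by
  refine HasValue.sum _ fun i _ => ((HasValue.const _).mul
    ((hasValue_polylog_cons one_pos [] (by simp) hx).pow i)).mul ?_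
  cases n - i with
  | zero => exact hasValue_polylog_cons (by norm_num) _ (fun s => pos_of_mem_ones) hx
  | succ j => exact hasValue_polylog_cons one_pos _ (fun s => pos_of_mem_ones_append) hx

lemma tendsto_logConvolution_value (m k : ℕ) :
    Tendsto (fun t : ℝ => ∑ i ∈ Finset.range (m + 1 + 1),
      (-1) ^ i / (i.factorial : ℝ) * polylogValue [1] (-t) ^ i *
        polylogValue (ones (m + 1 - i) ++ 3 :: ones k) (-t)) (𝓝[<] 1)
      (𝓝 (∑ i ∈ Finset.range (m + 1), Real.log 2 ^ i / (i.factorial : ℝ) *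
          zeta (-1 :: (ones (m - i) ++ 3 :: ones k))
        + Real.log 2 ^ (m + 1) / ((m + 1).factorial : ℝ) * zeta (-3 :: ones k))) := by
  have hlog (i : ℕ) : Tendsto (fun t : ℝ => (-1) ^ i / (i.factorial : ℝ) *
      polylogValue [1] (-t) ^ i) (𝓝[<] 1) (𝓝 (Real.log 2 ^ i / (i.factorial : ℝ))) := by
    have h := (tendsto_polylogValue_one_neg.pow i).const_mul ((-1) ^ i / (i.factorial : ℝ))
    have e : (-1) ^ i / (i.factorial : ℝ) * (-Real.log 2) ^ i
        = Real.log 2 ^ i / (i.factorial : ℝ) := by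
      rw [div_mul_eq_mul_div, ← mul_pow, neg_one_mul, neg_neg]
    rwa [e] at h
  -- The term i = m+1 is split off: no leading 1 remains in it, so at -1 the bar falls on the 3.
  simp only [Finset.sum_range_succ _ (m + 1)]
  refine Tendsto.add (tendsto_finsetSum _ fun i hi => (hlog i).mul ?_) ((hlog _).mul ?_)
  · rw [Nat.succ_sub (Nat.lt_succ_iff.1 (Finset.mem_range.1 hi))]
    exact tendsto_polylogValue_neg one_pos _ fun s => pos_of_mem_ones_append
  · rw [Nat.sub_self]
    exact tendsto_polylogValue_neg (by norm_num) _ fun s => pos_of_mem_ones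

/-! ### The limit of the formal identity at -1, and the theorem. -/

theorem log_two_zeta_three_identity (m k : ℕ) :
    (-1 : ℝ) ^ (m + 1) * (∑ i ∈ Finset.range (m + 1), Real.log 2 ^ i / (i.factorial : ℝ) *
          zeta (-1 :: (ones (m - i) ++ 3 :: ones k))
        + Real.log 2 ^ (m + 1) / ((m + 1).factorial : ℝ) * zeta (-3 :: ones k))
      + (-1 : ℝ) ^ (k + 1) * (∑ i ∈ Finset.range (k + 1), Real.log 2 ^ i / (i.factorial : ℝ) *
          zeta (-1 :: (ones (k - i) ++ 3 :: ones m))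
        + Real.log 2 ^ (k + 1) / ((k + 1).factorial : ℝ) * zeta (-3 :: ones m))
      = zeta (-2 :: ones m) * zeta (-2 :: ones k) := by
  have hA (d : ℕ) : Tendsto (fun t : ℝ => polylogValue (2 :: ones d) (-t)) (𝓝[<] 1)
      (𝓝 (zeta (-2 :: ones d))) :=
    tendsto_polylogValue_neg (by norm_num) _ fun s => pos_of_mem_ones
  refine tendsto_nhds_unique_of_eventuallyEq
    (((tendsto_logConvolution_value m k).const_mul _).add
      ((tendsto_logConvolution_value k m).const_mul _)) ((hA m).mul (hA k)) ?_
  filter_upwards [Ioo_mem_nhdsLT (show (0 : ℝ) < 1 by norm_num)] with t ht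
  have hx : |-t| < 1 := by rw [abs_neg, abs_of_pos ht.1]; exact ht.2
  have hsign (j : ℕ) : HasValue (-t) ((-1) ^ j) ((-1) ^ j) := by
    simpa using (HasValue.const (x := -t) (-1)).pow j
  have h1 := ((hsign (m + 1)).mul (hasValue_logConvolution hx (m + 1) k)).add
    ((hsign (k + 1)).mul (hasValue_logConvolution hx (k + 1) m))
  rw [logConvolution_add_logConvolution] at h1
  exact h1.unique ((hasValue_polylog_cons (by norm_num) _ (fun s => pos_of_mem_ones) hx).mul
    (hasValue_polylog_cons (by norm_num) _ (fun s => pos_of_mem_ones) hx))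

end AltMZV

theorem corollary4p2 (m k : ℕ) :
    -- every multiple zeta value that occurs is a convergent series
    ((∀ i ∈ Finset.range (m + 1),
        AltMZV.Converges ([-1] ++ AltMZV.ones (m - i) ++ [3] ++ AltMZV.ones k)) ∧
      (∀ i ∈ Finset.range (k + 1),
        AltMZV.Converges ([-1] ++ AltMZV.ones (k - i) ++ [3] ++ AltMZV.ones m)) ∧
      AltMZV.Converges ([-3] ++ AltMZV.ones k) ∧
      AltMZV.Converges ([-3] ++ AltMZV.ones m) ∧
      AltMZV.Converges ([-2] ++ AltMZV.ones m) ∧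
      AltMZV.Converges ([-2] ++ AltMZV.ones k)) ∧
    -- the identity
    (-1 : ℝ) ^ (m + 1) * ∑ i ∈ Finset.range (m + 1),
          Real.log 2 ^ i / (i.factorial : ℝ) *
            AltMZV.zeta ([-1] ++ AltMZV.ones (m - i) ++ [3] ++ AltMZV.ones k)
        + (-1 : ℝ) ^ (k + 1) * ∑ i ∈ Finset.range (k + 1),
          Real.log 2 ^ i / (i.factorial : ℝ) *
            AltMZV.zeta ([-1] ++ AltMZV.ones (k - i) ++ [3] ++ AltMZV.ones m)
      = (-1 : ℝ) ^ m / ((m + 1).factorial : ℝ) * Real.log 2 ^ (m + 1) *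
            AltMZV.zeta ([-3] ++ AltMZV.ones k)
        + (-1 : ℝ) ^ k / ((k + 1).factorial : ℝ) * Real.log 2 ^ (k + 1) *
            AltMZV.zeta ([-3] ++ AltMZV.ones m)
        + AltMZV.zeta ([-2] ++ AltMZV.ones m) * AltMZV.zeta ([-2] ++ AltMZV.ones k) := by
  have e (j k : ℕ) : [-1] ++ AltMZV.ones j ++ [3] ++ AltMZV.ones k
      = -1 :: (AltMZV.ones j ++ 3 :: AltMZV.ones k) := by simp
  simp only [e]
  simp only [List.singleton_append]
  refine ⟨⟨fun i _ => AltMZV.converges_neg_cons one_pos _ fun s => AltMZV.pos_of_mem_ones_append,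
    fun i _ => AltMZV.converges_neg_cons one_pos _ fun s => AltMZV.pos_of_mem_ones_append,
    AltMZV.converges_neg_cons (by norm_num) _ fun s => AltMZV.pos_of_mem_ones,
    AltMZV.converges_neg_cons (by norm_num) _ fun s => AltMZV.pos_of_mem_ones,
    AltMZV.converges_neg_cons (by norm_num) _ fun s => AltMZV.pos_of_mem_ones,
    AltMZV.converges_neg_cons (by norm_num) _ fun s => AltMZV.pos_of_mem_ones⟩, ?_⟩
  -- (-1)^(m+1) = -(-1)^m accounts for the signs of the ζ(3̄, …) terms once they are moved to the
  -- right.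
  rw [← AltMZV.log_two_zeta_three_identity m k, pow_succ, pow_succ]
  ring
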